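/- A set-of-lists partition (s-partition) of a finite set $S$ is a partition of $S$ into a set of nonempty lists (blocks), i.e. every element of $S$ occurs exactly once in exactly one of the lists; its size is $|S|$. It is standard if $S=\{1,\dots,n\}$ for some $n\ge 0$ (the empty s-partition is allowed). A run is a block of the form $a,a+1,\dots,a+\ell-1$ with $\ell\ge 1$. To delete a run from a standard s-partition means to remove it and to replace, in what is left, the smallest entry by $1$, the second smallest by $2$, and so on. To insert the run $i+1,\dots,i+j$, where $j\ge 1$ and $0\le i\le|\pi|$, into a standard s-partition $\pi$ means to increase by $j$ all entries of $\pi$ that exceed $i$ and to adjoin the list $i+1,\dots,i+j$ as a new block. A set $\mathcal F$ of standard s-partitions is run-closed if it is closed under all insertions and deletions of runs. Theorem. Let $\mathcal F$ be a run-closed family of standard s-partitions, and let $f(x)=\sum_{n\ge 0}|\{\pi\in\mathcal F:|\pi|=n\}|\,x^n$ be its generating function by size. Then the run transform of $f$ is the generating function of $\mathcal F$ by size and number of runs: as formal power series in $x$ and $y$, $$\sum_{n,k\ge 0}\bigl|\{\pi\in\mathcal F:\ |\pi|=n,\ \pi \text{ has exactly } k \text{ runs}\}\bigr|\,x^n y^k=\frac{1-x}{1-xy}\;f\!\left(\frac{x(1-x)}{1-xy}\right).$$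 -/

import Mathlib

/-- A set-of-lists partition (s-partition) of a finite set of natural numbers: a finite set of
nonempty, repetition-free, pairwise disjoint lists, called blocks. -/
@[ext]
structure SPartition where
  blocks : Finset (List ℕ)
  ne_nil : ∀ b ∈ blocks, b ≠ []
  nodup : ∀ b ∈ blocks, b.Nodup
  disjoint : ∀ b ∈ blocks, ∀ c ∈ blocks, b ≠ c → List.Disjoint b c

/-- A list is a run if it is `a, a + 1, …, a + ℓ - 1` for some `a` and some `ℓ ≥ 1`. -/
def IsRun (b : List ℕ) : Prop := ∃ a ℓ : ℕ, 0 < ℓ ∧ b = List.range' a ℓ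

theorem isRun_iff (b : List ℕ) : b ≠ [] ∧ b = List.range' b.headI b.length ↔ IsRun b := by
  constructor
  · rintro ⟨h0, h⟩
    exact ⟨_, _, List.length_pos_iff.2 h0, h⟩
  · rintro ⟨a, ℓ, hl, rfl⟩
    obtain ⟨m, rfl⟩ : ∃ m, ℓ = m + 1 := ⟨ℓ - 1, by omega⟩
    simp [List.range'_succ]

instance : DecidablePred IsRun := fun b => decidable_of_iff _ (isRun_iff b)

namespace SPartition

/-- The set that is partitioned. -/
def support (π : SPartition) : Finset ℕ := π.blocks.biUnion List.toFinset

theorem mem_support_of_mem {π : SPartition} {b : List ℕ} (hb : b ∈ π.blocks) {x : ℕ}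
    (hx : x ∈ b) : x ∈ π.support :=
  Finset.mem_biUnion.2 ⟨b, hb, List.mem_toFinset.2 hx⟩

/-- The size of an s-partition: the cardinality of its support. -/
def size (π : SPartition) : ℕ := π.support.card

/-- An s-partition is standard if its support is `{1, …, n}` for some `n ≥ 0`. -/
def IsStandard (π : SPartition) : Prop := ∃ n : ℕ, π.support = Finset.Icc 1 n

/-- The number of blocks that are runs. -/
def numRuns (π : SPartition) : ℕ := (π.blocks.filter IsRun).card

/-- Relabel all entries of an s-partition by a map that is injective on the support. -/
def relabel (π : SPartition) (f : ℕ → ℕ) (hf : Set.InjOn f (π.support : Set ℕ)) :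
    SPartition where
  blocks := π.blocks.image (List.map f)
  ne_nil := by
    simp only [Finset.mem_image]
    rintro _ ⟨b, hb, rfl⟩
    simpa using π.ne_nil b hb
  nodup := by
    simp only [Finset.mem_image]
    rintro _ ⟨b, hb, rfl⟩
    exact List.Nodup.map_on
      (fun x hx y hy h => hf (mem_support_of_mem hb hx) (mem_support_of_mem hb hy) h)
      (π.nodup b hb)
  disjoint := by
    simp only [Finset.mem_image]
    rintro _ ⟨b, hb, rfl⟩ _ ⟨c, hc, rfl⟩ hne x hxb hxc
    obtain ⟨y, hy, rfl⟩ := List.mem_map.1 hxb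
    obtain ⟨z, hz, hzy⟩ := List.mem_map.1 hxc
    have hzy' : z = y := hf (mem_support_of_mem hc hz) (mem_support_of_mem hb hy) hzy
    subst hzy'
    exact π.disjoint b hb c hc (fun h => hne (by rw [h])) hy hz

/-- The rank of `x` in the finite set `s`: the smallest element of `s` has rank `1`,
the second smallest has rank `2`, and so on. -/
def rank (s : Finset ℕ) (x : ℕ) : ℕ := (s.filter (· ≤ x)).card

theorem rank_injOn (s : Finset ℕ) : Set.InjOn (rank s) (s : Set ℕ) := by
  have key : ∀ x ∈ s, ∀ y ∈ s, x < y → rank s x < rank s y := by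
    intro x _ y hy hxy
    refine Finset.card_lt_card (Finset.ssubset_iff_of_subset ?_ |>.2 ⟨y, ?_, ?_⟩)
    · intro z hz
      simp only [Finset.mem_filter] at hz ⊢
      exact ⟨hz.1, hz.2.trans hxy.le⟩
    · simpa using hy
    · simp [hxy]
  intro x hx y hy h
  rcases lt_trichotomy x y with hlt | heq | hgt
  · exact absurd h (key x hx y hy hlt).ne
  · exact heq
  · exact absurd h (key y hy x hx hgt).ne'

/-- Standardize: replace the smallest entry by `1`, the second smallest by `2`, and so on. -/
def standardize (π : SPartition) : SPartition :=
  π.relabel (rank π.support) (rank_injOn π.support)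

/-- Remove a block, without relabelling. -/
def removeBlock (π : SPartition) (b : List ℕ) : SPartition where
  blocks := π.blocks.erase b
  ne_nil c hc := π.ne_nil c (Finset.mem_of_mem_erase hc)
  nodup c hc := π.nodup c (Finset.mem_of_mem_erase hc)
  disjoint c hc d hd := π.disjoint c (Finset.mem_of_mem_erase hc) d (Finset.mem_of_mem_erase hd)

/-- Delete the run `b`: remove it and standardize what is left. -/
def deleteRun (π : SPartition) (b : List ℕ) : SPartition := (π.removeBlock b).standardize

/-- The map that increments by `j` all numbers that exceed `i`. -/
def shift (i j x : ℕ) : ℕ := if i < x then x + j else x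

theorem shift_injective (i j : ℕ) : Function.Injective (shift i j) := by
  intro x y h
  unfold shift at h
  split_ifs at h <;> omega

theorem disjoint_range'_map_shift (i j : ℕ) (b : List ℕ) :
    List.Disjoint (List.range' (i + 1) j) (b.map (shift i j)) := by
  intro x hx hx'
  obtain ⟨y, _, rfl⟩ := List.mem_map.1 hx'
  rw [List.mem_range'_1] at hx
  unfold shift at hx
  split_ifs at hx <;> omega

/-- Insert the run `i + 1, …, i + j` (`j ≥ 1`): increment by `j` all entries that exceed `i` and
adjoin `i + 1, …, i + j` as a new block. -/
def insertRun (π : SPartition) (i j : ℕ) (hj : 0 < j) : SPartition where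
  blocks := insert (List.range' (i + 1) j) (π.relabel (shift i j) (shift_injective i j).injOn).blocks
  ne_nil := by
    intro b hb
    rcases Finset.mem_insert.1 hb with rfl | hb
    · simpa using hj.ne'
    · exact ne_nil _ b hb
  nodup := by
    intro b hb
    rcases Finset.mem_insert.1 hb with rfl | hb
    · exact List.nodup_range'
    · exact nodup _ b hb
  disjoint := by
    intro b hb c hc hne
    rcases Finset.mem_insert.1 hb with rfl | hb <;> rcases Finset.mem_insert.1 hc with rfl | hc
    · exact absurd rfl hne
    · obtain ⟨d, _, rfl⟩ := Finset.mem_image.1 hc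
      exact disjoint_range'_map_shift i j d
    · obtain ⟨d, _, rfl⟩ := Finset.mem_image.1 hb
      exact (disjoint_range'_map_shift i j d).symm
    · exact SPartition.disjoint _ b hb c hc hne

/-- A family of s-partitions is run-closed if it consists of standard s-partitions and is closed
under deletion of runs and under insertion of runs `i + 1, …, i + j` with `j ≥ 1` and
`0 ≤ i ≤ |π|`. -/
structure RunClosed (F : Set SPartition) : Prop where
  standard : ∀ π ∈ F, π.IsStandard
  delete : ∀ π ∈ F, ∀ b ∈ π.blocks, IsRun b → π.deleteRun b ∈ F
  insert : ∀ π ∈ F, ∀ (i j : ℕ) (hj : 0 < j), i ≤ π.size → π.insertRun i j hj ∈ F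

/-- There are finitely many standard s-partitions of a given size, so that the cardinalities
in the generating functions below are genuine. -/
theorem finite_standard (n : ℕ) : {π : SPartition | π.IsStandard ∧ π.size = n}.Finite := by
  have hL : {l : List ℕ | l.Nodup ∧ ∀ x ∈ l, x ∈ Finset.Icc 1 n}.Finite := by
    refine Set.Finite.subset
      ((List.finite_length_le (Finset.Icc 1 n) n).image (List.map Subtype.val)) ?_
    rintro l ⟨hl, hx⟩
    refine ⟨l.attach.map (fun x => ⟨x.1, hx x.1 x.2⟩), ?_, ?_⟩
    · have h1 : l.toFinset ⊆ Finset.Icc 1 n := fun x h => hx x (List.mem_toFinset.1 h)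
      have h2 := Finset.card_le_card h1
      rw [List.toFinset_card_of_nodup hl, Nat.card_Icc] at h2
      simpa using h2
    · simp [List.map_map, Function.comp_def]
  refine Set.Finite.of_finite_image (f := blocks)
    ((hL.toFinset.powerset.finite_toSet).subset ?_) (fun π _ ρ _ h => SPartition.ext h)
  rintro _ ⟨π, ⟨⟨m, hm⟩, hs⟩, rfl⟩
  have hmn : m = n := by
    rw [size, hm, Nat.card_Icc] at hs
    omega
  subst hmn
  simp only [Finset.coe_powerset, Set.mem_preimage, Set.mem_powerset_iff]
  intro b hb
  simp only [Set.Finite.coe_toFinset, Set.mem_ofPred_eq]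
  exact ⟨π.nodup b hb, fun x hx => hm ▸ mem_support_of_mem hb hx⟩

/-- The generating function `∑ₙ #{π ∈ F : |π| = n} xⁿ` of a family by size. -/
noncomputable def sizeGF (F : Set SPartition) : PowerSeries ℚ :=
  PowerSeries.mk fun n => ({π ∈ F | π.size = n}.ncard : ℚ)

/-- The generating function `∑ₙₖ #{π ∈ F : |π| = n, π has k runs} xⁿ yᵏ` of a family by size and
number of runs, where `x = X 0` and `y = X 1`. -/
noncomputable def sizeRunGF (F : Set SPartition) : MvPowerSeries (Fin 2) ℚ :=
  fun m => ({π ∈ F | π.size = m 0 ∧ π.numRuns = m 1}.ncard : ℚ)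

end SPartition

/-- The run transform `(1 - x) / (1 - x y) * f (x (1 - x) / (1 - x y))` of a power series `f`, a
formal power series in `x = X 0` and `y = X 1`. -/
noncomputable def runTransform (f : PowerSeries ℚ) : MvPowerSeries (Fin 2) ℚ :=
  let x : MvPowerSeries (Fin 2) ℚ := MvPowerSeries.X 0
  let y : MvPowerSeries (Fin 2) ℚ := MvPowerSeries.X 1
  (1 - x) * (1 - x * y)⁻¹ * f.subst (x * (1 - x) * (1 - x * y)⁻¹)

/-- The inverse of `1 - x y` in the run transform is genuine. -/
theorem runTransform_inv :
    (1 - (MvPowerSeries.X 0 * MvPowerSeries.X 1 : MvPowerSeries (Fin 2) ℚ)) *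
      (1 - MvPowerSeries.X 0 * MvPowerSeries.X 1)⁻¹ = 1 :=
  MvPowerSeries.mul_inv_cancel _ (by simp)

/-- The substitution in the run transform is genuine. -/
theorem runTransform_hasSubst :
    PowerSeries.HasSubst ((MvPowerSeries.X 0 : MvPowerSeries (Fin 2) ℚ) * (1 - MvPowerSeries.X 0) *
      (1 - MvPowerSeries.X 0 * MvPowerSeries.X 1)⁻¹) :=
  PowerSeries.HasSubst.of_constantCoeff_zero (by simp)

/-!
Write `q = (1 - x) / (1 - x y)`, let `aₙ` be the number of members of size `n` of the run-closed
family, and for `d ≥ 0` let `G_d` be the generating function, by `p` and `k`, of the members of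
size `p + d` that have exactly `k` runs contained in `{1, …, p}` (`prefixGF`). Then `G_0` is the
generating function by size and number of runs. It is computed by varying `p`.

A run contained in `{1, …, p}` either is contained in `{1, …, p - 1}` or ends at `p`, and at most
one run ends at `p`. Let `E_d` count the members of size `p + d` with a run ending at `p`, by `p`
and by the number of runs contained in `{1, …, p - 1}` (`endGF`). Comparing the counts for `p` and
`p - 1` gives `G_d = a_d + x G_{d+1} + (y - 1) E_d` (`RunClosed.prefixGF_add_endGF`). On the other
hand, deleting a run `i + 1, …, p` is a bijection onto the members of size `i + d`
(`RunClosed.bijOn_insertRun`), and the runs contained in `{1, …, p - 1}` become those contained in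
`{1, …, i}` (`runsUpTo_insertRun`). Summing over `i < p` gives `E_d = x (G_d + E_d)`
(`RunClosed.endGF_eq`). Eliminating `E_d` leaves `G_d = q (a_d + x G_{d+1})`
(`RunClosed.prefixGF_eq`).

The run transform of `∑ₙ a_{n+d} xⁿ` satisfies the same recurrence in `d` (`runTransform_eq`), and
the recurrence determines its solution, since the difference `D` of two solutions satisfies
`D_d = q x D_{d+1}` and so is divisible by all powers of `x` (`eq_zero_of_eq_mul_X_mul_succ`).
The case `d = 0` is the theorem.
-/

namespace SPartition

/-! ### Insertion and deletion of runs as mutually inverse operations -/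

theorem blocks_insertRun (π : SPartition) (i j : ℕ) (hj : 0 < j) :
    (π.insertRun i j hj).blocks =
      insert (List.range' (i + 1) j) (π.blocks.image (List.map (shift i j))) := rfl

theorem mem_support {π : SPartition} {x : ℕ} : x ∈ π.support ↔ ∃ b ∈ π.blocks, x ∈ b := by
  simp [support]

theorem IsStandard.support_eq {π : SPartition} (h : π.IsStandard) :
    π.support = Finset.Icc 1 π.size := by
  obtain ⟨n, hn⟩ := h
  rw [size, hn, Nat.card_Icc, Nat.add_sub_cancel]

/-- Blocks of an s-partition that share an entry are equal. -/
theorem eq_of_mem_of_mem {π : SPartition} {b c : List ℕ} (hb : b ∈ π.blocks) (hc : c ∈ π.blocks)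
    {x : ℕ} (hxb : x ∈ b) (hxc : x ∈ c) : b = c := by
  by_contra h
  exact π.disjoint b hb c hc h hxb hxc

theorem range'_notMem_image_shift (B : Finset (List ℕ)) (i j : ℕ) (hj : 0 < j) :
    List.range' (i + 1) j ∉ B.image (List.map (shift i j)) := by
  intro h
  obtain ⟨c, -, hc⟩ := Finset.mem_image.1 h
  have hx : i + 1 ∈ List.range' (i + 1) j := by rw [List.mem_range'_1]; omega
  exact disjoint_range'_map_shift i j c hx (hc ▸ hx)

theorem insertRun_injective (i j : ℕ) (hj : 0 < j) :
    Function.Injective fun π : SPartition => π.insertRun i j hj := by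
  intro π ρ h
  have h' := congrArg blocks h
  simp only [blocks_insertRun] at h'
  have h'' := congrArg (Finset.erase · (List.range' (i + 1) j)) h'
  simp only [Finset.erase_insert (range'_notMem_image_shift _ i j hj)] at h''
  exact SPartition.ext (Finset.image_injective
    (List.map_injective_iff.2 (shift_injective i j)) h'')

theorem size_insertRun (π : SPartition) (i j : ℕ) (hj : 0 < j) :
    (π.insertRun i j hj).size = π.size + j := by
  have hs : (π.insertRun i j hj).support =
      (List.range' (i + 1) j).toFinset ∪ π.support.image (shift i j) := by
    ext x
    simp only [mem_support, blocks_insertRun, Finset.mem_union, Finset.mem_insert,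
      Finset.mem_image, List.mem_toFinset]
    constructor
    · rintro ⟨b, rfl | ⟨c, hc, rfl⟩, hx⟩
      · exact Or.inl hx
      · obtain ⟨y, hy, rfl⟩ := List.mem_map.1 hx
        exact Or.inr ⟨y, ⟨c, hc, hy⟩, rfl⟩
    · rintro (hx | ⟨y, ⟨c, hc, hy⟩, rfl⟩)
      · exact ⟨_, Or.inl rfl, hx⟩
      · exact ⟨_, Or.inr ⟨c, hc, rfl⟩, List.mem_map_of_mem hy⟩
  have hd : Disjoint (List.range' (i + 1) j).toFinset (π.support.image (shift i j)) := by
    rw [Finset.disjoint_left]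
    intro x hx hx'
    obtain ⟨y, -, rfl⟩ := Finset.mem_image.1 hx'
    exact disjoint_range'_map_shift i j [y] (List.mem_toFinset.1 hx) (by simp)
  rw [size, hs, Finset.card_union_of_disjoint hd, List.toFinset_card_of_nodup List.nodup_range',
    List.length_range', Finset.card_image_of_injective _ (shift_injective i j), size, add_comm]

/-- Removing an interval from `{1, …, n}` and taking ranks is undone by shifting. -/
theorem shift_rank {s : Finset ℕ} {i j n : ℕ} (hij : i + j ≤ n)
    (hs : s = Finset.Icc 1 n \ Finset.Icc (i + 1) (i + j)) {x : ℕ} (hx : x ∈ s) :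
    shift i j (rank s x) = x := by
  have hx' := hx
  simp only [hs, Finset.mem_sdiff, Finset.mem_Icc] at hx'
  by_cases hxi : x ≤ i
  · have : s.filter (· ≤ x) = Finset.Icc 1 x := by
      ext y
      simp only [hs, Finset.mem_filter, Finset.mem_sdiff, Finset.mem_Icc]
      omega
    rw [rank, this, Nat.card_Icc, shift]
    split_ifs <;> omega
  · have : s.filter (· ≤ x) = Finset.Icc 1 x \ Finset.Icc (i + 1) (i + j) := by
      ext y
      simp only [hs, Finset.mem_filter, Finset.mem_sdiff, Finset.mem_Icc]
      omega
    have hc : rank s x = x - j := by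
      rw [rank, this, Finset.card_sdiff_of_subset (Finset.Icc_subset_Icc (by omega) (by omega)),
        Nat.card_Icc, Nat.card_Icc]
      omega
    rw [hc, shift]
    split_ifs <;> omega

theorem insertRun_deleteRun {π : SPartition} (hπ : π.IsStandard) {i j : ℕ} (hj : 0 < j)
    (hb : List.range' (i + 1) j ∈ π.blocks) :
    (π.deleteRun (List.range' (i + 1) j)).insertRun i j hj = π := by
  set b := List.range' (i + 1) j with hbdef
  have hle : i + j ≤ π.size := by
    have := mem_support_of_mem hb (x := i + j) (by rw [hbdef, List.mem_range'_1]; omega)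
    rw [hπ.support_eq, Finset.mem_Icc] at this
    exact this.2
  have hs : (π.removeBlock b).support =
      Finset.Icc 1 π.size \ Finset.Icc (i + 1) (i + j) := by
    ext x
    have hxb : x ∈ Finset.Icc (i + 1) (i + j) ↔ x ∈ b := by
      rw [hbdef, List.mem_range'_1, Finset.mem_Icc]
      omega
    rw [Finset.mem_sdiff, hxb, ← hπ.support_eq, mem_support, mem_support]
    constructor
    · rintro ⟨c, hc, hx⟩
      have hc' := Finset.mem_erase.1 hc
      exact ⟨⟨c, hc'.2, hx⟩, fun h => hc'.1 (eq_of_mem_of_mem hc'.2 hb hx h)⟩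
    · rintro ⟨⟨c, hc, hx⟩, hn⟩
      exact ⟨c, Finset.mem_erase.2 ⟨fun h => hn (h ▸ hx), hc⟩, hx⟩
  apply SPartition.ext
  have him : ((π.deleteRun b).blocks).image (List.map (shift i j)) = π.blocks.erase b := by
    change (((π.blocks.erase b).image (List.map (rank (π.removeBlock b).support))).image
      (List.map (shift i j))) = _
    rw [Finset.image_image]
    conv_rhs => rw [← Finset.image_id (s := π.blocks.erase b)]
    refine Finset.image_congr fun c hc => ?_
    simp only [Function.comp_apply, List.map_map, id]
    refine (List.map_congr_left fun x hx => ?_).trans (List.map_id c)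
    exact shift_rank hle hs (mem_support_of_mem (π := π.removeBlock b) hc hx)
  rw [blocks_insertRun, him, ← hbdef, Finset.insert_erase hb]

/-- Inserting the run `i + 1, …, i + j` is a bijection from the members of size `n ≥ i` of a
run-closed family onto its members of size `n + j` that have this run as a block. -/
theorem RunClosed.bijOn_insertRun {F : Set SPartition} (hF : RunClosed F) {i j n : ℕ}
    (hj : 0 < j) (hi : i ≤ n) :
    Set.BijOn (fun π => π.insertRun i j hj) {π ∈ F | π.size = n}
      {π ∈ F | π.size = n + j ∧ List.range' (i + 1) j ∈ π.blocks} := by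
  refine ⟨?_, (insertRun_injective i j hj).injOn, ?_⟩
  · rintro π ⟨hπ, rfl⟩
    exact ⟨hF.insert π hπ i j hj hi, size_insertRun π i j hj, Finset.mem_insert_self _ _⟩
  · rintro π ⟨hπ, hn, hb⟩
    have h := insertRun_deleteRun (hF.standard π hπ) hj hb
    refine ⟨_, ⟨hF.delete π hπ _ hb ⟨_, _, hj, rfl⟩, ?_⟩, h⟩
    have := size_insertRun (π.deleteRun (List.range' (i + 1) j)) i j hj
    rw [h] at this
    omega

/-! ### Runs contained in an initial interval -/

/-- The runs among the blocks that have all their entries at most `p`. -/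
def runsUpTo (π : SPartition) (p : ℕ) : Finset (List ℕ) :=
  π.blocks.filter fun b => IsRun b ∧ ∀ x ∈ b, x ≤ p

/-- Some block is a run with largest entry `p` and all entries positive. -/
def HasRunEndingAt (π : SPartition) (p : ℕ) : Prop :=
  ∃ i < p, List.range' (i + 1) (p - i) ∈ π.blocks

theorem card_runsUpTo_zero {π : SPartition} (hπ : π.IsStandard) : (π.runsUpTo 0).card = 0 := by
  rw [Finset.card_eq_zero, runsUpTo, Finset.filter_eq_empty_iff]
  rintro b hb ⟨-, h⟩
  obtain ⟨x, hx⟩ := List.exists_mem_of_ne_nil b (π.ne_nil b hb)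
  have := mem_support_of_mem hb hx
  rw [hπ.support_eq, Finset.mem_Icc] at this
  have := h x hx
  omega

theorem card_runsUpTo_size {π : SPartition} (hπ : π.IsStandard) :
    (π.runsUpTo π.size).card = π.numRuns := by
  rw [runsUpTo, numRuns]
  congr 1
  refine Finset.filter_congr fun b hb => ⟨fun h => h.1, fun h => ⟨h, fun x hx => ?_⟩⟩
  have := mem_support_of_mem hb hx
  rw [hπ.support_eq, Finset.mem_Icc] at this
  exact this.2

theorem runsUpTo_mono (π : SPartition) {p q : ℕ} (h : p ≤ q) : π.runsUpTo p ⊆ π.runsUpTo q :=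
  Finset.monotone_filter_right _ fun _ _ hb => ⟨hb.1, fun x hx => (hb.2 x hx).trans h⟩

theorem exists_eq_range'_of_mem_runsUpTo_sdiff {π : SPartition} (hπ : π.IsStandard) {p : ℕ}
    {b : List ℕ} (hb : b ∈ π.runsUpTo (p + 1) \ π.runsUpTo p) :
    ∃ i < p + 1, b = List.range' (i + 1) (p + 1 - i) := by
  simp only [runsUpTo, Finset.mem_sdiff, Finset.mem_filter, not_and, not_forall, not_le] at hb
  obtain ⟨⟨hb, ⟨a, l, hl, rfl⟩, hle⟩, h⟩ := hb
  obtain ⟨x, hx, hxp⟩ := h hb ⟨a, l, hl, rfl⟩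
  have h1 := mem_support_of_mem hb (x := a) (by rw [List.mem_range'_1]; omega)
  rw [hπ.support_eq, Finset.mem_Icc] at h1
  have h2 := hle (a + l - 1) (by rw [List.mem_range'_1]; omega)
  rw [List.mem_range'_1] at hx
  exact ⟨a - 1, by omega, by congr 1 <;> omega⟩

theorem card_runsUpTo_succ_of_not {π : SPartition} (hπ : π.IsStandard) {p : ℕ}
    (h : ¬π.HasRunEndingAt (p + 1)) : (π.runsUpTo (p + 1)).card = (π.runsUpTo p).card := by
  congr 1
  refine (Finset.Subset.antisymm (π.runsUpTo_mono p.le_succ) ?_).symm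
  rw [← Finset.sdiff_eq_empty_iff_subset, Finset.eq_empty_iff_forall_notMem]
  intro b hb
  obtain ⟨i, hi, rfl⟩ := exists_eq_range'_of_mem_runsUpTo_sdiff hπ hb
  exact h ⟨i, hi, (Finset.mem_filter.1 (Finset.mem_sdiff.1 hb).1).1⟩

theorem card_runsUpTo_succ_of_hasRunEndingAt {π : SPartition} (hπ : π.IsStandard) {p : ℕ}
    (h : π.HasRunEndingAt (p + 1)) : (π.runsUpTo (p + 1)).card = (π.runsUpTo p).card + 1 := by
  obtain ⟨i, hi, hb⟩ := h
  have hmem : p + 1 ∈ List.range' (i + 1) (p + 1 - i) := by rw [List.mem_range'_1]; omega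
  have hn : List.range' (i + 1) (p + 1 - i) ∉ π.runsUpTo p := fun h => by
    have := (Finset.mem_filter.1 h).2.2 _ hmem
    omega
  rw [← Finset.card_insert_of_notMem hn]
  congr 1
  apply Finset.Subset.antisymm
  · intro c hc
    by_cases hcp : c ∈ π.runsUpTo p
    · exact Finset.mem_insert_of_mem hcp
    · obtain ⟨k, hk, rfl⟩ :=
        exists_eq_range'_of_mem_runsUpTo_sdiff hπ (Finset.mem_sdiff.2 ⟨hc, hcp⟩)
      rw [eq_of_mem_of_mem (Finset.mem_filter.1 hc).1 hb (x := p + 1)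
        (by rw [List.mem_range'_1]; omega) hmem]
      exact Finset.mem_insert_self _ _
  · refine Finset.insert_subset (Finset.mem_filter.2 ⟨hb, ⟨_, _, by omega, rfl⟩, fun x hx => ?_⟩)
      (π.runsUpTo_mono p.le_succ)
    rw [List.mem_range'_1] at hx
    omega

/-- After inserting the run `i + 1, …, p + 1`, the runs contained in `{1, …, p}` are the old runs
contained in `{1, …, i}`: an entry above `i` is moved above `p`, and the new run ends at `p + 1`. -/
theorem runsUpTo_insertRun (π : SPartition) {i p : ℕ} (hi : i < p + 1) :
    (π.insertRun i (p + 1 - i) (Nat.sub_pos_of_lt hi)).runsUpTo p = π.runsUpTo i := by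
  have hfix : ∀ c : List ℕ, (∀ x ∈ c, x ≤ i) → c.map (shift i (p + 1 - i)) = c := fun c hc =>
    (List.map_congr_left fun x hx => if_neg (hc x hx).not_gt).trans (List.map_id c)
  ext b
  simp only [runsUpTo, Finset.mem_filter, blocks_insertRun, Finset.mem_insert, Finset.mem_image]
  constructor
  · rintro ⟨rfl | ⟨c, hc, rfl⟩, hr, hle⟩
    · have := hle (p + 1) (by rw [List.mem_range'_1]; omega)
      omega
    · have hci : ∀ x ∈ c, x ≤ i := fun x hx => by
        have := hle _ (List.mem_map_of_mem hx)
        unfold shift at this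
        split_ifs at this <;> omega
      rw [hfix c hci] at hr ⊢
      exact ⟨hc, hr, hci⟩
  · rintro ⟨hb, hr, hle⟩
    exact ⟨Or.inr ⟨b, hb, hfix b hle⟩, hr, fun x hx => (hle x hx).trans (by omega)⟩

/-! ### Counting recurrences -/

/-- The number of members of size `p + d` with exactly `k` runs contained in `{1, …, p}`. -/
noncomputable def prefixCount (F : Set SPartition) (d p k : ℕ) : ℕ :=
  {π ∈ F | π.size = p + d ∧ (π.runsUpTo p).card = k}.ncard

/-- The number of members of size `p + d` with a run whose largest entry is `p` and exactly `k`
runs contained in `{1, …, p - 1}`. -/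
noncomputable def endCount (F : Set SPartition) (d p k : ℕ) : ℕ :=
  {π ∈ F | π.size = p + d ∧ π.HasRunEndingAt p ∧ (π.runsUpTo (p - 1)).card = k}.ncard

theorem RunClosed.finite_of_size {F : Set SPartition} (hF : RunClosed F) (n : ℕ)
    {s : Set SPartition} (hs : s ⊆ {π ∈ F | π.size = n}) : s.Finite :=
  (finite_standard n).subset fun π hπ => ⟨hF.standard π (hs hπ).1, (hs hπ).2⟩

theorem endCount_zero (F : Set SPartition) (d k : ℕ) : endCount F d 0 k = 0 := by
  rw [endCount, Set.eq_empty_of_forall_notMem (s := {π | _}), Set.ncard_empty]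
  rintro π ⟨-, -, ⟨i, hi, -⟩, -⟩
  omega

theorem RunClosed.prefixCount_zero_zero {F : Set SPartition} (hF : RunClosed F) (d : ℕ) :
    prefixCount F d 0 0 = {π ∈ F | π.size = d}.ncard := by
  rw [prefixCount]
  congr 1
  ext π
  simp only [Set.mem_ofPred_eq, zero_add]
  exact ⟨fun h => ⟨h.1, h.2.1⟩, fun h => ⟨h.1, h.2, card_runsUpTo_zero (hF.standard π h.1)⟩⟩

theorem RunClosed.prefixCount_zero_succ {F : Set SPartition} (hF : RunClosed F) (d k : ℕ) :
    prefixCount F d 0 (k + 1) = 0 := by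
  rw [prefixCount, Set.eq_empty_of_forall_notMem (s := {π | _}), Set.ncard_empty]
  rintro π ⟨h, -, hk⟩
  rw [card_runsUpTo_zero (hF.standard π h)] at hk
  omega

/-- The number of members of size `p + 1 + d` without a run with largest entry `p + 1` that have
exactly `k` runs contained in `{1, …, p}`. -/
noncomputable def noEndCount (F : Set SPartition) (d p k : ℕ) : ℕ :=
  {π ∈ F | π.size = p + 1 + d ∧ ¬π.HasRunEndingAt (p + 1) ∧ (π.runsUpTo p).card = k}.ncard

theorem RunClosed.prefixCount_succ_left {F : Set SPartition} (hF : RunClosed F) (d p k : ℕ) :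
    prefixCount F (d + 1) p k = noEndCount F d p k + endCount F d (p + 1) k := by
  rw [prefixCount, noEndCount, endCount, ← Set.ncard_union_eq ?_
    (hF.finite_of_size (p + 1 + d) fun π h => ⟨h.1, h.2.1⟩)
    (hF.finite_of_size (p + 1 + d) fun π h => ⟨h.1, h.2.1⟩)]
  · congr 1
    ext π
    have : p + (d + 1) = p + 1 + d := by omega
    simp only [Set.mem_ofPred_eq, Set.mem_union, Nat.add_sub_cancel, this]
    tauto
  · rw [Set.disjoint_left]
    rintro π ⟨-, -, h, -⟩ ⟨-, -, h', -⟩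
    exact h h'

theorem RunClosed.prefixCount_succ_zero {F : Set SPartition} (hF : RunClosed F) (d p : ℕ) :
    prefixCount F d (p + 1) 0 = noEndCount F d p 0 := by
  rw [prefixCount, noEndCount]
  congr 1
  ext π
  simp only [Set.mem_ofPred_eq]
  refine and_congr_right fun hπ => and_congr_right fun _ => ?_
  by_cases h : π.HasRunEndingAt (p + 1)
  · simp [h, card_runsUpTo_succ_of_hasRunEndingAt (hF.standard π hπ) h]
  · simp [h, card_runsUpTo_succ_of_not (hF.standard π hπ) h]

theorem RunClosed.prefixCount_succ_succ {F : Set SPartition} (hF : RunClosed F) (d p k : ℕ) :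
    prefixCount F d (p + 1) (k + 1) = noEndCount F d p (k + 1) + endCount F d (p + 1) k := by
  rw [prefixCount, noEndCount, endCount, ← Set.ncard_union_eq ?_
    (hF.finite_of_size (p + 1 + d) fun π h => ⟨h.1, h.2.1⟩)
    (hF.finite_of_size (p + 1 + d) fun π h => ⟨h.1, h.2.1⟩)]
  · congr 1
    ext π
    simp only [Set.mem_ofPred_eq, Set.mem_union, Nat.add_sub_cancel, ← and_or_left]
    refine and_congr_right fun hπ => and_congr_right fun _ => ?_
    by_cases h : π.HasRunEndingAt (p + 1)
    · simp [h, card_runsUpTo_succ_of_hasRunEndingAt (hF.standard π hπ) h]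
    · simp [h, card_runsUpTo_succ_of_not (hF.standard π hπ) h]
  · rw [Set.disjoint_left]
    rintro π ⟨-, -, h, -⟩ ⟨-, -, h', -⟩
    exact h h'

/-- Deleting a run `i + 1, …, p + 1` leaves a member of size `i + d`, and the runs contained in
`{1, …, p}` become those contained in `{1, …, i}`. -/
theorem RunClosed.endCount_succ_eq_sum {F : Set SPartition} (hF : RunClosed F) (d p k : ℕ) :
    endCount F d (p + 1) k = ∑ i ∈ Finset.range (p + 1), prefixCount F d i k := by
  let T : ℕ → Set SPartition := fun i => {π ∈ F | π.size = p + 1 + d ∧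
    List.range' (i + 1) (p + 1 - i) ∈ π.blocks ∧ (π.runsUpTo p).card = k}
  have hT : ∀ i ∈ Finset.range (p + 1), (T i).ncard = prefixCount F d i k := by
    intro i hi
    rw [Finset.mem_range] at hi
    have hbij := hF.bijOn_insertRun (i := i) (n := i + d) (Nat.sub_pos_of_lt hi) (by omega)
    have hsize : i + d + (p + 1 - i) = p + 1 + d := by omega
    rw [hsize] at hbij
    refine (Set.BijOn.ncard_eq (f := fun π => π.insertRun i (p + 1 - i) (Nat.sub_pos_of_lt hi))
      ⟨?_, (insertRun_injective _ _ _).injOn, ?_⟩).symm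
    · rintro π ⟨hπ, hn, hk⟩
      have := hbij.mapsTo ⟨hπ, hn⟩
      refine ⟨this.1, this.2.1, this.2.2, ?_⟩
      rw [runsUpTo_insertRun π hi, hk]
    · rintro π ⟨hπ, hn, hb, hk⟩
      obtain ⟨ρ, hρ, rfl⟩ := hbij.surjOn ⟨hπ, hn, hb⟩
      refine ⟨ρ, ⟨hρ.1, hρ.2, ?_⟩, rfl⟩
      rwa [runsUpTo_insertRun ρ hi] at hk
  have hU : {π ∈ F | π.size = p + 1 + d ∧ π.HasRunEndingAt (p + 1) ∧
      (π.runsUpTo (p + 1 - 1)).card = k} = ⋃ i ∈ (Finset.range (p + 1) : Set ℕ), T i := by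
    ext π
    simp only [HasRunEndingAt, Set.mem_ofPred_eq, Set.mem_iUnion, Finset.coe_range, Set.mem_Iio,
      Nat.add_sub_cancel, T]
    constructor
    · rintro ⟨h1, h2, ⟨i, hi, hb⟩, h3⟩
      exact ⟨i, hi, h1, h2, hb, h3⟩
    · rintro ⟨i, hi, h1, h2, hb, h3⟩
      exact ⟨h1, h2, ⟨i, hi, hb⟩, h3⟩
  rw [endCount, hU, Set.Finite.ncard_biUnion (Finset.finite_toSet _), finsum_mem_coe_finset]
  · exact Finset.sum_congr rfl hT
  · exact fun i _ => hF.finite_of_size (p + 1 + d) fun π h => ⟨h.1, h.2.1⟩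
  · intro i hi i' hi' hne
    rw [Function.onFun, Set.disjoint_left]
    rintro π ⟨-, -, hb, -⟩ ⟨-, -, hb', -⟩
    simp only [Finset.coe_range, Set.mem_Iio] at hi hi'
    have h := congrArg List.length (eq_of_mem_of_mem hb hb' (x := p + 1)
      (by rw [List.mem_range'_1]; omega) (by rw [List.mem_range'_1]; omega))
    simp only [List.length_range'] at h
    omega

theorem RunClosed.endCount_succ {F : Set SPartition} (hF : RunClosed F) (d p k : ℕ) :
    endCount F d (p + 1) k = prefixCount F d p k + endCount F d p k := by
  rw [hF.endCount_succ_eq_sum, Finset.sum_range_succ, add_comm]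
  cases p with
  | zero => simp [endCount_zero]
  | succ p => rw [hF.endCount_succ_eq_sum]

end SPartition

/-! ### Bivariate power series given by their coefficients -/

/-- The power series `∑ₙₖ aₙₖ xⁿ yᵏ`, where `x = X 0` and `y = X 1`. -/
def bivariateSeries (a : ℕ → ℕ → ℚ) : MvPowerSeries (Fin 2) ℚ := fun m => a (m 0) (m 1)

theorem coeff_bivariateSeries (a : ℕ → ℕ → ℚ) (m : Fin 2 →₀ ℕ) :
    MvPowerSeries.coeff m (bivariateSeries a) = a (m 0) (m 1) := rfl

theorem X_zero_mul_bivariateSeries (a : ℕ → ℕ → ℚ) :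
    MvPowerSeries.X 0 * bivariateSeries a =
      bivariateSeries fun n k => if 1 ≤ n then a (n - 1) k else 0 := by
  ext m
  rw [MvPowerSeries.X, MvPowerSeries.coeff_monomial_mul, coeff_bivariateSeries]
  simp [coeff_bivariateSeries, Finsupp.single_le_iff]

theorem X_one_mul_bivariateSeries (a : ℕ → ℕ → ℚ) :
    MvPowerSeries.X 1 * bivariateSeries a =
      bivariateSeries fun n k => if 1 ≤ k then a n (k - 1) else 0 := by
  ext m
  rw [MvPowerSeries.X, MvPowerSeries.coeff_monomial_mul, coeff_bivariateSeries]
  simp [coeff_bivariateSeries, Finsupp.single_le_iff]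

theorem C_eq_bivariateSeries (c : ℚ) :
    (MvPowerSeries.C c : MvPowerSeries (Fin 2) ℚ) =
      bivariateSeries fun n k => if n = 0 ∧ k = 0 then c else 0 := by
  ext m
  rw [MvPowerSeries.coeff_C, coeff_bivariateSeries]
  simp [Finsupp.ext_iff, Fin.forall_fin_two]

theorem bivariateSeries_add (a b : ℕ → ℕ → ℚ) :
    bivariateSeries a + bivariateSeries b = bivariateSeries fun n k => a n k + b n k := rfl

/-! ### The recurrence for the generating functions -/

namespace SPartition

/-- The generating function `∑ₚₖ (prefixCount F d p k) xᵖ yᵏ`. -/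
noncomputable def prefixGF (F : Set SPartition) (d : ℕ) : MvPowerSeries (Fin 2) ℚ :=
  bivariateSeries fun p k => (prefixCount F d p k : ℚ)

/-- The generating function `∑ₚₖ (endCount F d p k) xᵖ yᵏ`. -/
noncomputable def endGF (F : Set SPartition) (d : ℕ) : MvPowerSeries (Fin 2) ℚ :=
  bivariateSeries fun p k => (endCount F d p k : ℚ)

theorem RunClosed.endGF_eq {F : Set SPartition} (hF : RunClosed F) (d : ℕ) :
    endGF F d = MvPowerSeries.X 0 * (prefixGF F d + endGF F d) := by
  rw [prefixGF, endGF, bivariateSeries_add, X_zero_mul_bivariateSeries]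
  congr 1
  funext p k
  cases p with
  | zero => simp [endCount_zero]
  | succ p => simp [hF.endCount_succ]

theorem RunClosed.prefixGF_add_endGF {F : Set SPartition} (hF : RunClosed F) (d : ℕ) :
    prefixGF F d + endGF F d =
      MvPowerSeries.C ((sizeGF F).coeff d) + MvPowerSeries.X 0 * prefixGF F (d + 1) +
        MvPowerSeries.X 1 * endGF F d := by
  rw [prefixGF, prefixGF, endGF, C_eq_bivariateSeries, X_zero_mul_bivariateSeries,
    X_one_mul_bivariateSeries, bivariateSeries_add, bivariateSeries_add, bivariateSeries_add]
  congr 1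
  funext p k
  rcases p with _ | p <;> rcases k with _ | k
  · simp [endCount_zero, hF.prefixCount_zero_zero, sizeGF]
  · simp [endCount_zero, hF.prefixCount_zero_succ]
  · simp [hF.prefixCount_succ_zero, hF.prefixCount_succ_left]
  · simp [hF.prefixCount_succ_succ, hF.prefixCount_succ_left]
    ring

/-- Eliminating `endGF` from its two linear relations with `prefixGF`. -/
theorem RunClosed.prefixGF_eq {F : Set SPartition} (hF : RunClosed F) (d : ℕ) :
    prefixGF F d =
      (1 - MvPowerSeries.X 0) * (1 - MvPowerSeries.X 0 * MvPowerSeries.X 1)⁻¹ *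
        (MvPowerSeries.C ((sizeGF F).coeff d) + MvPowerSeries.X 0 * prefixGF F (d + 1)) := by
  have h1 := hF.endGF_eq d
  have h2 := hF.prefixGF_add_endGF d
  have h3 := runTransform_inv
  generalize (1 - MvPowerSeries.X 0 * MvPowerSeries.X 1 : MvPowerSeries (Fin 2) ℚ)⁻¹ = u at *
  generalize (MvPowerSeries.X 0 : MvPowerSeries (Fin 2) ℚ) = x at *
  generalize (MvPowerSeries.X 1 : MvPowerSeries (Fin 2) ℚ) = y at *
  linear_combination (-prefixGF F d) * h3 + u * (1 - x) * h2 + u * (y - 1) * h1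

theorem RunClosed.sizeRunGF_eq_prefixGF {F : Set SPartition} (hF : RunClosed F) :
    sizeRunGF F = prefixGF F 0 := by
  funext m
  simp only [sizeRunGF, prefixGF, bivariateSeries, prefixCount, add_zero]
  congr 2
  ext π
  simp only [Set.mem_ofPred_eq]
  refine and_congr_right fun hπ => and_congr_right fun hs => ?_
  rw [← hs, card_runsUpTo_size (hF.standard π hπ)]

end SPartition

/-! ### The recurrence for the run transform -/

/-- With `q = (1 - x) / (1 - x y)`, the run transform of `f` is `q * f(x q)`; this is what becomes
of `f = C (f.coeff 0) + X * (tail of f)` when `x q` is substituted for `X`. -/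
theorem runTransform_eq (f : PowerSeries ℚ) :
    runTransform f =
      (1 - MvPowerSeries.X 0) * (1 - MvPowerSeries.X 0 * MvPowerSeries.X 1)⁻¹ *
        (MvPowerSeries.C (f.coeff 0) +
          MvPowerSeries.X 0 * runTransform (PowerSeries.mk fun n => f.coeff (n + 1))) := by
  have hf := PowerSeries.eq_X_mul_shift_add_const f
  have hs := runTransform_hasSubst
  simp only [runTransform]
  conv_lhs => rw [hf]
  rw [PowerSeries.subst_add hs, PowerSeries.subst_mul hs, PowerSeries.subst_X hs,
    PowerSeries.subst_C, PowerSeries.coeff_zero_eq_constantCoeff_apply]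
  ring

/-- A sequence of power series satisfying `Dₐ = q X₀ Dₐ₊₁` vanishes, as each power of `X₀`
divides all of its members. -/
theorem eq_zero_of_eq_mul_X_mul_succ {q : MvPowerSeries (Fin 2) ℚ}
    {D : ℕ → MvPowerSeries (Fin 2) ℚ} (h : ∀ d, D d = q * (MvPowerSeries.X 0 * D (d + 1)))
    (d : ℕ) : D d = 0 := by
  have hdvd : ∀ N d, (MvPowerSeries.X 0 : MvPowerSeries (Fin 2) ℚ) ^ N ∣ D d := by
    intro N
    induction N with
    | zero => simp
    | succ N ih =>
      intro d
      rw [h d, pow_succ']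
      exact (mul_dvd_mul_left _ (ih (d + 1))).mul_left q
  ext m
  exact MvPowerSeries.X_pow_dvd_iff.1 (hdvd (m 0 + 1) d) m (Nat.lt_succ_self _)

theorem theorem8 (F : Set SPartition) (hF : SPartition.RunClosed F) :
    SPartition.sizeRunGF F = runTransform (SPartition.sizeGF F) := by
  let tail : ℕ → PowerSeries ℚ := fun d =>
    PowerSeries.mk fun n => (SPartition.sizeGF F).coeff (n + d)
  have htail : ∀ d, (PowerSeries.mk fun n => (tail d).coeff (n + 1)) = tail (d + 1) := fun d => by
    ext n
    simp only [tail, PowerSeries.coeff_mk]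
    rw [add_right_comm, add_assoc]
  -- The run transforms of the tails of the size series and the series `prefixGF F d` satisfy the
  -- same recurrence.
  have key := eq_zero_of_eq_mul_X_mul_succ
    (q := (1 - MvPowerSeries.X 0) * (1 - MvPowerSeries.X 0 * MvPowerSeries.X 1)⁻¹)
    (D := fun d => SPartition.prefixGF F d - runTransform (tail d)) (fun d => by
      have h := runTransform_eq (tail d)
      have h0 : (tail d).coeff 0 = (SPartition.sizeGF F).coeff d := by simp [tail]
      rw [htail, h0] at h
      linear_combination hF.prefixGF_eq d - h) 0
  have h0 : tail 0 = SPartition.sizeGF F := by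
    ext n
    simp [tail]
  rw [hF.sizeRunGF_eq_prefixGF, ← h0]
  exact sub_eq_zero.1 key
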